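/- Let $(a_n)_{n\ge1}$ and $(b_{n,j})_{n,j\ge1}$ be real numbers such that $a_n\ge 0$ and $b_{n,j}\ge 0$ for all $n,j\ge1$, and $b_{n,j}=0$ whenever $n\ge j$. Let $w=(w_n)_{n\ge1}$ be a real sequence with $w_n\ge n$ for all $n\ge 1$, and suppose that there is $\kappa\in(0,1]$ with $$\sum_{n=1}^{j-1} w_n b_{n,j}\le \kappa\, w_j\qquad (j=2,3,\ldots).$$ For a positive sequence $v=(v_n)_{n\ge1}$ let $\ell^1_v$ be the space of real sequences $f=(f_n)_{n\ge1}$ with $\|f\|_v=\sum_{n\ge1} v_n|f_n|<\infty$, ordered componentwise. Define operators in $\ell^1_w$ by $$A^{(w)}f=(-a_nf_n)_{n\ge1},\qquad B^{(w)}f=\Bigl(\sum_{j=n+1}^{\infty}a_jb_{n,j}f_j\Bigr)_{n\ge1},$$ on their maximal domains: $\mathcal D(A^{(w)})$, respectively $\mathcal D(B^{(w)})$, consists of those $f\in\ell^1_w$ for which the stated expression is well defined and belongs to $\ell^1_w$. The sum $A^{(w)}+B^{(w)}$ has domain $\mathcal D(A^{(w)})\cap\mathcal D(B^{(w)})$.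 A $C_0$-semigroup $(S(t))_{t\ge0}$ on $\ell^1_w$ is called substochastic (respectively stochastic) if, for all $t\ge 0$ and all $f\ge0$, one has $S(t)f\ge0$ and $\|S(t)f\|_w\le\|f\|_w$ (respectively $\|S(t)f\|_w=\|f\|_w$). Then $A^{(w)}+B^{(w)}$ is closable, and its closure $G^{(w)}=\overline{A^{(w)}+B^{(w)}}$ is the generator of a substochastic $C_0$-semigroup $(S^{(w)}(t))_{t\ge0}$ on $\ell^1_w$. Moreover, let $(c_n)_{n\ge1}$ be any real sequence with $c_n\le c_{n+1}$ and $a_n\le c_n$ for all $n\ge1$, let $C^{(w)}f=(-c_nf_n)_{n\ge1}$ with domain $\mathcal D(C^{(w)})=\{f\in\ell^1_w:\sum_{n\ge1} w_nc_n|f_n|<\infty\}$, and let $\widetilde w_n=w_n+w_nc_n$. Then $\mathcal D(C^{(w)})=\ell^1_{\widetilde w}$, and this space is invariant under the semigroup: $S^{(w)}(t)\,\mathcal D(C^{(w)})\subseteq\mathcal D(C^{(w)})$ for all $t\ge0$. If, in addition, $a_1=0$, $\sum_{n=1}^{j-1}n\,b_{n,j}=j$ for all $j=2,3,\ldots$,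 and $w_n=n$ for all $n\ge1$, then the semigroup $(S^{(w)}(t))_{t\ge0}$ is stochastic on $\ell^1_w=X_{[1]}=\{f:\sum_{n\ge1} n|f_n|<\infty\}$. -/

import Mathlib

open Filter Topology
open scoped NNReal

noncomputable section

/-- A weight: a sequence `(w_n)_{n ≥ 1}` of strictly positive real numbers. -/
structure Weight where
  toFun : ℕ+ → ℝ
  pos : ∀ n, 0 < toFun n

instance : CoeFun Weight (fun _ => ℕ+ → ℝ) := ⟨Weight.toFun⟩

/-- The sequences `f` with `∑ v_n |f_n| < ∞`, as a subspace of the space of all real sequences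
(without any norm). -/
def weightedSeq (v : ℕ+ → ℝ) : Submodule ℝ (ℕ+ → ℝ) where
  carrier := {f | Summable fun n => v n * |f n|}
  zero_mem' := by
    simp
  add_mem' := by
    intro f g hf hg
    refine Summable.of_norm_bounded (g := fun n => |v n * (|f n|)| + |v n * (|g n|)|)
      (hf.abs.add hg.abs) (fun n => ?_)
    simp only [Real.norm_eq_abs, abs_mul, abs_abs, Pi.add_apply]
    rw [← mul_add]
    exact mul_le_mul_of_nonneg_left (abs_add_le _ _) (abs_nonneg _)
  smul_mem' := by
    intro c f hf
    refine (Summable.mul_left (|c|) (f := fun n => v n * |f n|) hf).congr (fun n => ?_)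
    simp only [Pi.smul_apply, smul_eq_mul, abs_mul]
    ring

/-- The Banach space `ℓ¹_w`. It is a type of its own, so that it carries the weighted norm
and not the topology of pointwise convergence. -/
def WeightedL1 (w : Weight) : Type := ↥(weightedSeq w)

namespace WeightedL1

variable {w : Weight}

instance : AddCommGroup (WeightedL1 w) := inferInstanceAs (AddCommGroup ↥(weightedSeq w))

instance : Module ℝ (WeightedL1 w) := inferInstanceAs (Module ℝ ↥(weightedSeq w))

/-- The inclusion of `ℓ¹_w` in the space of all real sequences. -/
def toSeq (w : Weight) : WeightedL1 w →ₗ[ℝ] (ℕ+ → ℝ) := (weightedSeq w).subtype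

instance : CoeFun (WeightedL1 w) (fun _ => ℕ+ → ℝ) := ⟨fun f => toSeq w f⟩

theorem summable (f : WeightedL1 w) : Summable fun n => w n * |f n| := f.2

/-- The norm `‖f‖_w = ∑ w_n |f_n|`. -/
instance : NormedAddCommGroup (WeightedL1 w) :=
  AddGroupNorm.toNormedAddCommGroup
    { toFun := fun f => ∑' n, w n * |f n|
      map_zero' := by simp
      add_le' := by
        intro f g
        rw [← (summable f).tsum_add (summable g)]
        refine (summable (f + g)).tsum_le_tsum (fun n => ?_) ((summable f).add (summable g))
        rw [← mul_add, map_add]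
        exact mul_le_mul_of_nonneg_left (abs_add_le _ _) (w.pos n).le
      neg' := by
        intro f
        simp
      eq_zero_of_map_eq_zero' := by
        intro f hf
        have h0 : ∀ n, 0 ≤ w n * |f n| := fun n => mul_nonneg (w.pos n).le (abs_nonneg _)
        have h := (hasSum_zero_iff_of_nonneg h0).1 (hf ▸ (summable f).hasSum)
        refine Subtype.ext (funext fun n => ?_)
        have hn : w n * |f n| = 0 := congrFun h n
        exact abs_eq_zero.1 ((mul_eq_zero.1 hn).resolve_left (w.pos n).ne') }

theorem norm_def (f : WeightedL1 w) : ‖f‖ = ∑' n, w n * |f n| := rfl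

instance : NormedSpace ℝ (WeightedL1 w) where
  norm_smul_le := by
    intro c f
    refine le_of_eq ?_
    change ∑' n, w n * |(c • f : WeightedL1 w) n| = ‖c‖ * ∑' n, w n * |f n|
    rw [← tsum_mul_left]
    refine tsum_congr fun n => ?_
    rw [map_smul, Pi.smul_apply, smul_eq_mul, abs_mul, Real.norm_eq_abs]
    ring

/-- The componentwise order on `ℓ¹_w`. -/
instance : PartialOrder (WeightedL1 w) := inferInstanceAs (PartialOrder ↥(weightedSeq w))

theorem nonneg_iff (f : WeightedL1 w) : 0 ≤ f ↔ ∀ n, 0 ≤ f n := Iff.rfl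

end WeightedL1

/-- The multiplication operator `f ↦ (m_n f_n)_n` in `ℓ¹_w` with its maximal domain
`{f ∈ ℓ¹_w : (m_n f_n)_n ∈ ℓ¹_w}`. -/
def diagOp (w : Weight) (m : ℕ+ → ℝ) : WeightedL1 w →ₗ.[ℝ] WeightedL1 w where
  domain :=
    { carrier := {f | (fun n => m n * f n) ∈ weightedSeq w}
      zero_mem' := by
        have h : (fun n => m n * (0 : WeightedL1 w) n) = 0 := by
          funext n
          simp
        exact Set.mem_ofPred.2 (h ▸ (weightedSeq w).zero_mem)
      add_mem' := by
        intro f g hf hg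
        have h : (fun n => m n * (f + g : WeightedL1 w) n)
            = (fun n => m n * f n) + fun n => m n * g n := by
          funext n
          simp [mul_add]
        exact Set.mem_ofPred.2 (h ▸ (weightedSeq w).add_mem hf hg)
      smul_mem' := by
        intro c f hf
        have h : (fun n => m n * (c • f : WeightedL1 w) n) = c • fun n => m n * f n := by
          funext n
          simp [mul_left_comm]
        exact Set.mem_ofPred.2 (h ▸ (weightedSeq w).smul_mem c hf) }
  toFun :=
    { toFun := fun f => ⟨fun n => m n * f.1 n, f.2⟩
      map_add' := by
        intro f g
        refine Subtype.ext (funext fun n => ?_)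
        change m n * (f.1 + g.1) n = m n * f.1 n + m n * g.1 n
        simp [mul_add]
      map_smul' := by
        intro c f
        refine Subtype.ext (funext fun n => ?_)
        change m n * (c • f.1 : WeightedL1 w) n = c * (m n * f.1 n)
        simp [mul_left_comm] }

/-- The operator `A^{(w)}`, `(A f)_n = -a_n f_n`, on its maximal domain in `ℓ¹_w`. -/
def opA (w : Weight) (a : ℕ+ → ℝ) : WeightedL1 w →ₗ.[ℝ] WeightedL1 w :=
  diagOp w (fun n => -a n)

/-- The operator `C^{(w)}`, `(C f)_n = -c_n f_n`, on the domain
`{f ∈ ℓ¹_w : ∑ w_n |c_n f_n| < ∞}`. -/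
def opC (w : Weight) (c : ℕ+ → ℝ) : WeightedL1 w →ₗ.[ℝ] WeightedL1 w :=
  diagOp w (fun n => -c n)

/-- The `j`-th term of the series `∑_{j > n} a_j b_{n,j} f_j`. -/
def gainTerm (a : ℕ+ → ℝ) (b : ℕ+ → ℕ+ → ℝ) (f : ℕ+ → ℝ) (n j : ℕ+) : ℝ :=
  if n < j then a j * b n j * f j else 0

/-- The series `∑_{j > n} a_j b_{n,j} f_j` converges to `s` (as the limit of its partial sums). -/
def HasGain (a : ℕ+ → ℝ) (b : ℕ+ → ℕ+ → ℝ) (f : ℕ+ → ℝ) (n : ℕ+) (s : ℝ) : Prop :=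
  Tendsto (fun N : ℕ+ => ∑ j ∈ Finset.Icc 1 N, gainTerm a b f n j) atTop (𝓝 s)

theorem HasGain.add {a : ℕ+ → ℝ} {b : ℕ+ → ℕ+ → ℝ} {f g : ℕ+ → ℝ} {n : ℕ+} {s t : ℝ}
    (hf : HasGain a b f n s) (hg : HasGain a b g n t) : HasGain a b (f + g) n (s + t) := by
  refine (Tendsto.add hf hg).congr fun N => ?_
  rw [← Finset.sum_add_distrib]
  refine Finset.sum_congr rfl fun j _ => ?_
  unfold gainTerm
  split_ifs
  · simp [mul_add]
  · simp

theorem HasGain.smul {a : ℕ+ → ℝ} {b : ℕ+ → ℕ+ → ℝ} {f : ℕ+ → ℝ} {n : ℕ+} {s : ℝ} (c : ℝ)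
    (hf : HasGain a b f n s) : HasGain a b (c • f) n (c * s) := by
  refine (Tendsto.const_mul c hf).congr fun N => ?_
  rw [Finset.mul_sum]
  refine Finset.sum_congr rfl fun j _ => ?_
  unfold gainTerm
  split_ifs
  · simp [mul_left_comm]
  · simp

/-- The operator `B^{(w)}`, `(B f)_n = ∑_{j > n} a_j b_{n,j} f_j`, on its maximal domain: those
`f ∈ ℓ¹_w` for which all these series converge and the sequence of their sums is in `ℓ¹_w`. -/
def opB (w : Weight) (a : ℕ+ → ℝ) (b : ℕ+ → ℕ+ → ℝ) : WeightedL1 w →ₗ.[ℝ] WeightedL1 w where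
  domain :=
    { carrier := {f | ∃ g : WeightedL1 w, ∀ n, HasGain a b f n (g n)}
      zero_mem' := by
        refine ⟨0, fun n => ?_⟩
        simp [HasGain, gainTerm]
      add_mem' := by
        rintro f g ⟨f', hf⟩ ⟨g', hg⟩
        refine ⟨f' + g', fun n => ?_⟩
        simpa using (hf n).add (hg n)
      smul_mem' := by
        rintro c f ⟨f', hf⟩
        refine ⟨c • f', fun n => ?_⟩
        simpa using (hf n).smul c }
  toFun :=
    { toFun := fun f => f.2.choose
      map_add' := by
        intro f g
        refine Subtype.ext (funext fun n => ?_)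
        have h1 := (f + g).2.choose_spec n
        have h2 := (f.2.choose_spec n).add (g.2.choose_spec n)
        exact tendsto_nhds_unique h1 h2
      map_smul' := by
        intro c f
        refine Subtype.ext (funext fun n => ?_)
        have h1 := (c • f).2.choose_spec n
        have h2 := (f.2.choose_spec n).smul c
        exact tendsto_nhds_unique h1 h2 }

/-- The components of `B^{(w)} f` are the sums of the series that define it. -/
theorem opB_apply (w : Weight) (a : ℕ+ → ℝ) (b : ℕ+ → ℕ+ → ℝ) (f : (opB w a b).domain) (n : ℕ+) :
    HasGain a b f.1 n (opB w a b f n) :=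
  f.2.choose_spec n

/-- A `C₀`-semigroup of bounded linear operators. -/
structure C0Semigroup (E : Type*) [NormedAddCommGroup E] [NormedSpace ℝ E] where
  op : ℝ≥0 → E →L[ℝ] E
  op_zero : op 0 = ContinuousLinearMap.id ℝ E
  op_add : ∀ s t, op (s + t) = (op s).comp (op t)
  continuous_orbit : ∀ x, Continuous fun t => op t x

namespace C0Semigroup

variable {E : Type*} [NormedAddCommGroup E] [NormedSpace ℝ E]

/-- `G` is the generator of `S`: its domain is the set of all `x` for which `(S(h)x - x) / h` has
a limit as `h → 0+`, and `G x` is this limit. -/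
def IsGeneratedBy (S : C0Semigroup E) (G : E →ₗ.[ℝ] E) : Prop :=
  ∀ x y : E, (x, y) ∈ G.graph ↔
    Tendsto (fun h : ℝ≥0 => (h : ℝ)⁻¹ • (S.op h x - x)) (𝓝[>] 0) (𝓝 y)

/-- Positivity preserving and norm-nonincreasing on the positive cone. -/
def IsSubstochastic [PartialOrder E] (S : C0Semigroup E) : Prop :=
  ∀ t, ∀ f : E, 0 ≤ f → 0 ≤ S.op t f ∧ ‖S.op t f‖ ≤ ‖f‖

/-- Positivity preserving and norm-preserving on the positive cone. -/
def IsStochastic [PartialOrder E] (S : C0Semigroup E) : Prop :=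
  ∀ t, ∀ f : E, 0 ≤ f → 0 ≤ S.op t f ∧ ‖S.op t f‖ = ‖f‖

/-- Every operator of the semigroup maps the subspace `D` into itself. -/
def LeavesInvariant (S : C0Semigroup E) (D : Submodule ℝ E) : Prop :=
  ∀ t, ∀ f ∈ D, S.op t f ∈ D

end C0Semigroup

end

/-! The matrix of `A + B` is upper triangular: the `j`-th unit vector is sent to a combination of
unit vectors with index at most `j`. So the span of the first `N` unit vectors is invariant, and `A
+ B` composed with the truncation `P N` is a bounded operator `G N`. With `α = a_1 + ... + a_N` the
operator `G N + α` has nonnegative entries and, because `∑ w_n b_{n,j} ≤ w_j`, norm at most `α`;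
hence `exp (t G N) = exp (-tα) exp (t (G N + α))` is a positive contraction. These exponentials are
consistent on the ranges of the truncations, whose union is dense, so they converge strongly to a
substochastic semigroup `S`.

The generator of `S` is the closure of `A + B` on finitely supported sequences. One inclusion is a
mean value estimate (`hasOrbitDeriv_of_mem_closure_core`); the other is a Lumer–Phillips argument
that combines dissipativity with the solvability of `u - G N u = y`
(`HasOrbitDeriv.mem_closure_core`). The maximal sum `A + B` lies between this core and its closure
(`core_subset_graph`, `graph_subset_closure_core`), which gives closability and the generator at
once.

By monotonicity of `c`, the weight `w_n (1 + c_n)` satisfies the same column inequality, and the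
semigroup built from it is the restriction of `S`; this is the invariance of the domain of `C`. In
the conservative case every column has total mass zero, so `S` preserves mass. -/

/-! ### Exponentials of bounded operators: contractivity, positivity, resolvent. -/

section Exponential

open NormedSpace

variable {E F : Type*} [NormedAddCommGroup E] [NormedSpace ℝ E] [CompleteSpace E]
  [NormedAddCommGroup F] [NormedSpace ℝ F] [CompleteSpace F]

theorem hasSum_exp_apply (X : E →L[ℝ] E) (f : E) :
    HasSum (fun n : ℕ => ((n.factorial : ℝ)⁻¹) • (X ^ n) f) (exp X f) := by
  have h := (exp_series_hasSum_exp' (𝕂 := ℝ) X).mapL (ContinuousLinearMap.apply ℝ E f)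
  simpa using h

/-- An operator that intertwines `X` and `Y` intertwines their exponentials. -/
theorem exp_apply_comm_of_comp_eq (T : E →L[ℝ] F) {X : E →L[ℝ] E} {Y : F →L[ℝ] F}
    (h : ∀ f, T (X f) = Y (T f)) (f : E) : T (exp X f) = exp Y (T f) := by
  have hpow : ∀ n : ℕ, T ((X ^ n) f) = (Y ^ n) (T f) := by
    intro n
    induction n with
    | zero => simp
    | succ n ih =>
      rw [pow_succ', pow_succ', ContinuousLinearMap.mul_def, ContinuousLinearMap.mul_def,
        ContinuousLinearMap.comp_apply, ContinuousLinearMap.comp_apply, h, ih]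
  have h1 := (hasSum_exp_apply X f).mapL T
  simp only [map_smul, hpow] at h1
  exact h1.unique (hasSum_exp_apply Y (T f))

theorem norm_exp_apply_le (X : E →L[ℝ] E) (f : E) : ‖exp X f‖ ≤ Real.exp ‖X‖ * ‖f‖ := by
  have h1 : HasSum (fun n : ℕ => ‖X‖ ^ n / n.factorial * ‖f‖) (Real.exp ‖X‖ * ‖f‖) := by
    have := expSeries_div_hasSum_exp (‖X‖)
    rw [← Real.exp_eq_exp_ℝ] at this
    exact this.mul_right _
  refine (hasSum_exp_apply X f).norm_le_of_bounded h1 fun n => ?_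
  have hpow : ‖(X ^ n) f‖ ≤ ‖X‖ ^ n * ‖f‖ := by
    induction n with
    | zero => simp
    | succ n ih =>
      rw [pow_succ', pow_succ', mul_assoc]
      exact (X.le_opNorm _).trans (mul_le_mul_of_nonneg_left ih (norm_nonneg _))
  rw [norm_smul, norm_inv, RCLike.norm_natCast, div_eq_inv_mul, mul_assoc]
  exact mul_le_mul_of_nonneg_left hpow (by positivity)

/-- The exponential of an operator preserving a closed cone preserves this cone. -/
theorem exp_apply_mem_cone {K : PointedCone ℝ E} (hK : IsClosed (K : Set E)) {X : E →L[ℝ] E}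
    (hX : ∀ f ∈ K, X f ∈ K) {f : E} (hf : f ∈ K) : exp X f ∈ K := by
  have hpow : ∀ n : ℕ, (X ^ n) f ∈ K := by
    intro n
    induction n with
    | zero => simpa
    | succ n ih => simpa [pow_succ'] using hX _ ih
  refine hK.mem_of_tendsto (hasSum_exp_apply X f) (Eventually.of_forall fun s => ?_)
  refine K.sum_mem fun n _ => ?_
  exact K.smul_mem (by positivity) (hpow n)

theorem exp_shift (X : E →L[ℝ] E) (r : ℝ) :
    exp X = Real.exp (-r) • exp (X + r • (1 : E →L[ℝ] E)) := by
  let _ : NormedAlgebra ℚ (E →L[ℝ] E) := NormedAlgebra.restrictScalars ℚ ℝ _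
  have h1 : X = (X + r • 1) + (-r) • (1 : E →L[ℝ] E) := by
    rw [neg_smul]; abel
  have h2 : exp ((-r) • (1 : E →L[ℝ] E)) = Real.exp (-r) • 1 := by
    rw [← Algebra.algebraMap_eq_smul_one, ← Algebra.algebraMap_eq_smul_one, Real.exp_eq_exp_ℝ]
    exact (algebraMap_exp_comm (𝕂 := ℝ) (-r)).symm
  conv_lhs => rw [h1]
  rw [exp_add_of_commute ((Commute.one_right _).smul_right _), h2, mul_smul_comm, mul_one]

/-- Norm bounds and cone invariance are available for `G + α` but not for `G` itself; this identity
transfers them to the exponential of `t • G` for `t ≥ 0`. -/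
theorem exp_smul_shift (G : E →L[ℝ] E) (t α : ℝ) :
    exp (t • G) = Real.exp (-(t * α)) • exp (t • (G + α • (1 : E →L[ℝ] E))) := by
  rw [exp_shift (t • G) (t * α), smul_add, mul_smul]

/-- If `‖G + α‖ ≤ α`, then `G` generates a contraction semigroup. -/
theorem norm_exp_smul_apply_le {G : E →L[ℝ] E} {α : ℝ}
    (h : ‖G + α • (1 : E →L[ℝ] E)‖ ≤ α) {t : ℝ} (ht : 0 ≤ t) (f : E) :
    ‖exp (t • G) f‖ ≤ ‖f‖ := by
  rw [exp_smul_shift G t α, smul_apply, norm_smul, Real.norm_eq_abs,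
    Real.abs_exp]
  have h1 : ‖t • (G + α • (1 : E →L[ℝ] E))‖ ≤ t * α := by
    rw [norm_smul, Real.norm_eq_abs, abs_of_nonneg ht]
    exact mul_le_mul_of_nonneg_left h ht
  calc _ ≤ Real.exp (-(t * α)) * (Real.exp (t * α) * ‖f‖) := by
        refine mul_le_mul_of_nonneg_left ((norm_exp_apply_le _ f).trans ?_) (Real.exp_nonneg _)
        exact mul_le_mul_of_nonneg_right (Real.exp_le_exp.2 h1) (norm_nonneg _)
    _ = ‖f‖ := by rw [← mul_assoc, ← Real.exp_add]; simp

theorem exp_smul_apply_mem_cone {K : PointedCone ℝ E} (hK : IsClosed (K : Set E))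
    {G : E →L[ℝ] E} {α : ℝ} (hG : ∀ f ∈ K, G f + α • f ∈ K) {t : ℝ} (ht : 0 ≤ t) {f : E}
    (hf : f ∈ K) : exp (t • G) f ∈ K := by
  rw [exp_smul_shift G t α, smul_apply]
  refine K.smul_mem (Real.exp_nonneg _) (exp_apply_mem_cone hK ?_ hf)
  intro g hg
  simpa using K.smul_mem ht (hG g hg)

/-- If `‖G + α‖ ≤ α`, then `1 - G` is surjective. -/
theorem exists_sub_apply_eq {G : E →L[ℝ] E} {α : ℝ}
    (h : ‖G + α • (1 : E →L[ℝ] E)‖ ≤ α) (y : E) : ∃ x, x - G x = y := by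
  have hα : 0 ≤ α := (norm_nonneg _).trans h
  have hα1 : 0 < 1 + α := by linarith
  set T : E →L[ℝ] E := (1 + α)⁻¹ • (G + α • (1 : E →L[ℝ] E)) with hT
  have hT1 : ‖T‖ < 1 := by
    rw [hT, norm_smul, norm_inv, Real.norm_eq_abs, abs_of_pos hα1, inv_mul_lt_one₀ hα1]
    linarith
  obtain ⟨u, hu⟩ : IsUnit (1 - T) := isUnit_one_sub_of_norm_lt_one hT1
  -- Since `1 - G = (1 + α)(1 - T)` and `‖T‖ < 1`, a Neumann series inverts `1 - G`.
  refine ⟨(1 + α)⁻¹ • (↑u⁻¹ : E →L[ℝ] E) y, ?_⟩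
  set z := (↑u⁻¹ : E →L[ℝ] E) y
  have hz : z - T z = y := by
    have : (1 - T) z = y := by
      rw [← hu]
      change ((u : E →L[ℝ] E) * (↑u⁻¹ : E →L[ℝ] E)) y = y
      rw [u.mul_inv]; rfl
    simpa using this
  rw [← hz, hT]
  simp only [map_smul, smul_apply, add_apply,
    one_apply_eq_self, smul_add, smul_smul]
  have : z = (1 + α)⁻¹ • z + ((1 + α)⁻¹ * α) • z := by
    rw [← add_smul, ← mul_one_add, inv_mul_cancel₀ hα1.ne', one_smul]
  nth_rewrite 3 [this]
  abel

end Exponential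

/-! ### Finite sections and their limit semigroup. -/

noncomputable section

/-- Bounded operators `G N` approximating an unbounded operator that leaves invariant the ranges
of the projections `P N`, with the estimate `‖G N + α N‖ ≤ α N` which makes each `G N` the
generator of a contraction semigroup. -/
structure FiniteSections (E : Type*) [NormedAddCommGroup E] [NormedSpace ℝ E] where
  P : ℕ+ → E →L[ℝ] E
  G : ℕ+ → E →L[ℝ] E
  α : ℕ+ → ℝ
  tendsto_P : ∀ f, Tendsto (fun N => P N f) atTop (𝓝 f)
  P_G : ∀ N f, P N (G N f) = G N f
  G_P : ∀ M N f, N ≤ M → G M (P N f) = G N f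
  norm_le : ∀ N, ‖G N + α N • (1 : E →L[ℝ] E)‖ ≤ α N

namespace FiniteSections

open NormedSpace

variable {E : Type*} [NormedAddCommGroup E] [NormedSpace ℝ E] [CompleteSpace E]
  (Φ : FiniteSections E)

/-- The graph of the common restriction of the operators `G N` to the ranges of the `P N`. -/
def core : Set (E × E) := {p | ∃ N f, p = (Φ.P N f, Φ.G N f)}

/-- `P N` intertwines `G N` with `G M`, because `G M ∘ P N = G N = P N ∘ G N`. On the range of `P N`
the approximating semigroups are therefore the same for all `M ≥ N`. -/
theorem exp_P {M N : ℕ+} (h : N ≤ M) (t : ℝ) (f : E) :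
    exp (t • Φ.G M) (Φ.P N f) = Φ.P N (exp (t • Φ.G N) f) := by
  refine (exp_apply_comm_of_comp_eq (Φ.P N) (fun g => ?_) f).symm
  simp [Φ.P_G, Φ.G_P M N g h]

theorem norm_exp_le (N : ℕ+) (t : ℝ≥0) (f : E) : ‖exp ((t : ℝ) • Φ.G N) f‖ ≤ ‖f‖ :=
  norm_exp_smul_apply_le (Φ.norm_le N) t.2 f

/-- For vectors `P N f` the sequence is eventually constant by `exp_P`; uniform contractivity
extends convergence to all `f`, by approximating `f` with `P N f`. -/
theorem exists_tendsto (t : ℝ≥0) (f : E) :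
    ∃ y, Tendsto (fun N => exp ((t : ℝ) • Φ.G N) f) atTop (𝓝 y) := by
  refine cauchySeq_tendsto_of_complete (Metric.cauchySeq_iff'.2 fun ε hε => ?_)
  obtain ⟨N, hN⟩ := (Metric.tendsto_atTop.1 (Φ.tendsto_P f)) (ε / 2) (half_pos hε)
  refine ⟨N, fun M hM => ?_⟩
  have key : ∀ L ≥ N, dist (exp ((t : ℝ) • Φ.G L) f) (Φ.P N (exp ((t : ℝ) • Φ.G N) f)) < ε / 2 := by
    intro L hL
    rw [← Φ.exp_P hL, dist_eq_norm, ← map_sub]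
    refine (Φ.norm_exp_le L t _).trans_lt ?_
    rw [← dist_eq_norm, dist_comm]
    exact hN N le_rfl
  calc _ ≤ _ := dist_triangle_right _ _ (Φ.P N (exp ((t : ℝ) • Φ.G N) f))
    _ < ε := by linarith [key M hM, key N le_rfl]

/-- The strong limit of the semigroups generated by the operators `G N`. -/
def limitFun (t : ℝ≥0) (f : E) : E := (Φ.exists_tendsto t f).choose

theorem tendsto_limitFun (t : ℝ≥0) (f : E) :
    Tendsto (fun N => exp ((t : ℝ) • Φ.G N) f) atTop (𝓝 (Φ.limitFun t f)) :=
  (Φ.exists_tendsto t f).choose_spec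

/-- The strong limit of the semigroups generated by the operators `G N`, as a bounded operator. -/
def limitOp (t : ℝ≥0) : E →L[ℝ] E :=
  LinearMap.mkContinuous
    { toFun := Φ.limitFun t
      map_add' := fun f g => tendsto_nhds_unique (Φ.tendsto_limitFun t _) <| by
        simpa using (Φ.tendsto_limitFun t f).add (Φ.tendsto_limitFun t g)
      map_smul' := fun c f => tendsto_nhds_unique (Φ.tendsto_limitFun t _) <| by
        simpa using (Φ.tendsto_limitFun t f).const_smul c }
    1 fun f => by
      rw [one_mul]
      exact le_of_tendsto (Φ.tendsto_limitFun t f).norm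
        (Eventually.of_forall fun N => Φ.norm_exp_le N t f)

theorem tendsto_limitOp (t : ℝ≥0) (f : E) :
    Tendsto (fun N => exp ((t : ℝ) • Φ.G N) f) atTop (𝓝 (Φ.limitOp t f)) :=
  Φ.tendsto_limitFun t f

theorem norm_limitOp_le (t : ℝ≥0) (f : E) : ‖Φ.limitOp t f‖ ≤ ‖f‖ :=
  le_of_tendsto (Φ.tendsto_limitOp t f).norm (Eventually.of_forall fun N => Φ.norm_exp_le N t f)

theorem limitOp_P (t : ℝ≥0) (N : ℕ+) (f : E) :
    Φ.limitOp t (Φ.P N f) = exp ((t : ℝ) • Φ.G N) (Φ.P N f) := by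
  refine tendsto_nhds_unique (Φ.tendsto_limitOp t _) (tendsto_const_nhds.congr' ?_)
  filter_upwards [eventually_ge_atTop N] with M hM
  rw [Φ.exp_P hM, Φ.exp_P le_rfl]

theorem limitOp_G (t : ℝ≥0) (N : ℕ+) (f : E) :
    Φ.limitOp t (Φ.G N f) = exp ((t : ℝ) • Φ.G N) (Φ.G N f) := by
  rw [← Φ.P_G, Φ.limitOp_P]

theorem hasDerivAt_exp_apply (N : ℕ+) (f : E) (t : ℝ) :
    HasDerivAt (fun s : ℝ => exp (s • Φ.G N) f) (exp (t • Φ.G N) (Φ.G N f)) t := by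
  have h := (hasDerivAt_exp_smul_const (𝕂 := ℝ) (Φ.G N) t).clm_apply (hasDerivAt_const t f)
  simpa using h

/-- The contraction semigroup of a system of finite sections. -/
def semigroup : C0Semigroup E where
  op := Φ.limitOp
  op_zero := by
    ext f
    refine tendsto_nhds_unique (Φ.tendsto_limitOp 0 f) ?_
    simp
  op_add s t := by
    ext f
    let _ : NormedAlgebra ℚ (E →L[ℝ] E) := NormedAlgebra.restrictScalars ℚ ℝ _
    refine tendsto_nhds_unique (Φ.tendsto_limitOp (s + t) f) ?_
    have h1 := Φ.tendsto_limitOp s (Φ.limitOp t f)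
    -- A product of strong limits: contractivity lets the inner exponential be replaced by its limit
    -- with an error tending to zero.
    have h2 : Tendsto (fun N => exp ((s : ℝ) • Φ.G N)
        (exp ((t : ℝ) • Φ.G N) f - Φ.limitOp t f)) atTop (𝓝 0) := by
      refine squeeze_zero_norm (fun N => Φ.norm_exp_le N s _) ?_
      simpa using ((Φ.tendsto_limitOp t f).sub_const (Φ.limitOp t f)).norm
    have h3 := h2.add h1
    rw [zero_add] at h3
    refine h3.congr fun N => ?_
    rw [map_sub, sub_add_cancel, NNReal.coe_add, add_smul, exp_add_of_commute]
    · rfl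
    · exact ((Commute.refl _).smul_left _).smul_right _
  continuous_orbit f := by
    -- The orbits of `P N f` are orbits of the norm-continuous group `exp (s • G N)`, and by
    -- contractivity they approximate the orbit of `f` uniformly in time.
    have hu : TendstoUniformly (fun N (t : ℝ≥0) => Φ.limitOp t (Φ.P N f))
        (fun t => Φ.limitOp t f) atTop := by
      refine Metric.tendstoUniformly_iff.2 fun ε hε => ?_
      filter_upwards [(Metric.tendsto_nhds.1 (Φ.tendsto_P f)) ε hε] with N hN t
      rw [dist_eq_norm, ← map_sub]
      refine (Φ.norm_limitOp_le t _).trans_lt ?_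
      rwa [← dist_eq_norm, dist_comm]
    refine hu.continuous (Frequently.of_forall fun N => ?_)
    simp only [Φ.limitOp_P]
    have h : Continuous fun s : ℝ => exp (s • Φ.G N) (Φ.P N f) :=
      continuous_iff_continuousAt.2 fun s => (Φ.hasDerivAt_exp_apply N _ s).continuousAt
    exact h.comp NNReal.continuous_coe

theorem semigroup_op (t : ℝ≥0) : Φ.semigroup.op t = Φ.limitOp t := rfl

theorem norm_op_le (t : ℝ≥0) (f : E) : ‖Φ.semigroup.op t f‖ ≤ ‖f‖ := Φ.norm_limitOp_le t f

/-- The semigroup is determined by intertwining relations between finite sections. -/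
theorem map_op_eq {F : Type*} [NormedAddCommGroup F] [NormedSpace ℝ F] [CompleteSpace F]
    (Ψ : FiniteSections F) (T : E →L[ℝ] F) (h : ∀ N f, T (Φ.G N f) = Ψ.G N (T f)) (t : ℝ≥0)
    (f : E) : T (Φ.semigroup.op t f) = Ψ.semigroup.op t (T f) := by
  refine tendsto_nhds_unique ((T.continuous.tendsto _).comp (Φ.tendsto_limitOp t f)) ?_
  refine (Ψ.tendsto_limitOp t (T f)).congr fun N => ?_
  exact (exp_apply_comm_of_comp_eq T (fun g => by simp [h]) f).symm

/-- A functional annihilating the ranges of the `G N` is conserved by the semigroup. -/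
theorem functional_op_eq (φ : E →L[ℝ] ℝ) (h : ∀ N f, φ (Φ.G N f) = 0) (t : ℝ≥0) (f : E) :
    φ (Φ.semigroup.op t f) = φ f := by
  refine tendsto_nhds_unique ((φ.continuous.tendsto _).comp (Φ.tendsto_limitOp t f))
    (tendsto_const_nhds.congr fun N => ?_)
  have := exp_apply_comm_of_comp_eq φ (X := (t : ℝ) • Φ.G N) (Y := 0) (fun g => by simp [h]) f
  simpa using this.symm

theorem op_mem_cone {K : PointedCone ℝ E} (hK : IsClosed (K : Set E))
    (hG : ∀ N, ∀ f ∈ K, Φ.G N f + Φ.α N • f ∈ K) (t : ℝ≥0) {f : E} (hf : f ∈ K) :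
    Φ.semigroup.op t f ∈ K :=
  hK.mem_of_tendsto (Φ.tendsto_limitOp t f)
    (Eventually.of_forall fun N => exp_smul_apply_mem_cone hK (hG N) t.2 hf)

/-! ### Identification of the generator with the closure of the core. -/

/-- `y` is the right derivative at `0` of the orbit of `x`. -/
def HasOrbitDeriv (x y : E) : Prop :=
  Tendsto (fun h : ℝ≥0 => (h : ℝ)⁻¹ • (Φ.semigroup.op h x - x)) (𝓝[>] 0) (𝓝 y)

/-- Mean value inequality for `s ↦ S(s)x' - s • y`, with derivative `S(s)(y' - y) + (S(s)y - y)`.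
The vector `y` is kept separate from `y'` so that both sides are continuous in `(x', y')` and the
bound passes to the closure of the core. -/
theorem norm_op_sub_sub_le_of_mem_core {x' y y' : E} (hx : (x', y') ∈ Φ.core) {δ : ℝ}
    {h : ℝ≥0} (hδ : ∀ s ≤ h, ‖Φ.semigroup.op s y - y‖ ≤ δ) :
    ‖Φ.semigroup.op h x' - x' - (h : ℝ) • y‖ ≤ (‖y' - y‖ + δ) * h := by
  obtain ⟨N, f, hf⟩ := hx
  obtain ⟨rfl, rfl⟩ := Prod.mk.inj hf
  have hder : ∀ s ∈ Set.Icc (0 : ℝ) h, HasDerivWithinAt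
      (fun s : ℝ => exp (s • Φ.G N) (Φ.P N f) - s • y)
      (exp (s • Φ.G N) (Φ.G N f) - y) (Set.Icc (0 : ℝ) h) s := by
    intro s _
    have h1 := Φ.hasDerivAt_exp_apply N (Φ.P N f) s
    rw [Φ.G_P N N f le_rfl] at h1
    have h2 := (hasDerivAt_id s).smul_const y
    rw [one_smul] at h2
    exact (h1.sub h2).hasDerivWithinAt
  have := norm_image_sub_le_of_norm_deriv_le_segment' hder (C := ‖Φ.G N f - y‖ + δ)
    (fun s hs => ?_) h ⟨h.2, le_rfl⟩
  · rw [semigroup_op, limitOp_P]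
    simpa [sub_right_comm] using this
  · lift s to ℝ≥0 using hs.1
    rw [← Φ.limitOp_G, ← semigroup_op]
    have h3 : Φ.semigroup.op s (Φ.G N f) - y
        = Φ.semigroup.op s (Φ.G N f - y) + (Φ.semigroup.op s y - y) := by
      rw [map_sub]; abel
    rw [h3]
    refine (norm_add_le _ _).trans (add_le_add (Φ.norm_op_le s _) (hδ s ?_))
    exact_mod_cast hs.2.le

theorem hasOrbitDeriv_of_mem_closure_core {x y : E} (hxy : (x, y) ∈ closure Φ.core) :
    Φ.HasOrbitDeriv x y := by
  have main : ∀ (h : ℝ≥0) (δ : ℝ), (∀ s ≤ h, ‖Φ.semigroup.op s y - y‖ ≤ δ) →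
      ‖Φ.semigroup.op h x - x - (h : ℝ) • y‖ ≤ δ * h := by
    -- At the limit point `(x, y)` the term `‖y' - y‖` vanishes and only `δ * h` remains.
    intro h δ hδ
    have := le_on_closure
      (f := fun p : E × E => ‖Φ.semigroup.op h p.1 - p.1 - (h : ℝ) • y‖)
      (g := fun p => (‖p.2 - y‖ + δ) * h)
      (fun p hp => Φ.norm_op_sub_sub_le_of_mem_core hp hδ) (by fun_prop) (by fun_prop) hxy
    simpa using this
  refine Metric.tendsto_nhds.2 fun ε hε => ?_
  have hcont : Tendsto (fun s => Φ.semigroup.op s y) (𝓝 0) (𝓝 y) := by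
    have := (Φ.semigroup.continuous_orbit y).tendsto 0
    rwa [Φ.semigroup.op_zero] at this
  obtain ⟨r, hr, hball⟩ := Metric.eventually_nhds_iff.1
    ((Metric.tendsto_nhds.1 hcont) (ε / 2) (half_pos hε))
  have hmem : ∀ᶠ h : ℝ≥0 in 𝓝[>] 0, dist h 0 < r :=
    nhdsWithin_le_nhds (Metric.ball_mem_nhds 0 hr)
  filter_upwards [hmem, self_mem_nhdsWithin] with h hhr hh0
  have hh : 0 < (h : ℝ) := NNReal.coe_pos.2 hh0
  have h1 := main h (ε / 2) fun s hs => by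
    rw [← dist_eq_norm]
    refine (hball ?_).le
    refine lt_of_le_of_lt ?_ hhr
    simpa [NNReal.dist_eq] using hs
  have h2 : (h : ℝ)⁻¹ • (Φ.semigroup.op h x - x) - y
      = (h : ℝ)⁻¹ • (Φ.semigroup.op h x - x - (h : ℝ) • y) := by
    rw [smul_sub _ _ ((h : ℝ) • y), smul_smul, inv_mul_cancel₀ hh.ne', one_smul]
  rw [dist_eq_norm, h2, norm_smul, norm_inv, Real.norm_eq_abs, abs_of_pos hh]
  calc _ ≤ (h : ℝ)⁻¹ * (ε / 2 * h) := mul_le_mul_of_nonneg_left h1 (by positivity)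
    _ = ε / 2 := by field_simp
    _ < ε := half_lt_self hε

variable {Φ}

theorem HasOrbitDeriv.sub {x y x' y' : E} (h : Φ.HasOrbitDeriv x y)
    (h' : Φ.HasOrbitDeriv x' y') : Φ.HasOrbitDeriv (x - x') (y - y') := by
  refine (Tendsto.sub h h').congr fun t => ?_
  rw [← smul_sub, map_sub]
  congr 1
  abel

/-- Dissipativity: by contractivity `(1 + 1/t) x - (1/t) S(t)x` has norm at least `‖x‖`, and it
tends to `x - y`. -/
theorem HasOrbitDeriv.norm_le {x y : E} (h : Φ.HasOrbitDeriv x y) : ‖x‖ ≤ ‖x - y‖ := by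
  refine ge_of_tendsto ((tendsto_const_nhds (x := x)).sub h).norm ?_
  filter_upwards [self_mem_nhdsWithin] with t ht0
  have ht : 0 < (t : ℝ) := NNReal.coe_pos.2 ht0
  have h1 : x - (t : ℝ)⁻¹ • (Φ.semigroup.op t x - x)
      = (1 + (t : ℝ)⁻¹) • x - (t : ℝ)⁻¹ • Φ.semigroup.op t x := by
    rw [add_smul, one_smul, smul_sub]; abel
  rw [h1]
  refine le_trans ?_ (norm_sub_norm_le _ _)
  have hi : 0 < (t : ℝ)⁻¹ := inv_pos.2 ht
  rw [norm_smul, norm_smul, Real.norm_eq_abs, Real.norm_eq_abs, abs_of_pos hi,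
    abs_of_pos (by linarith)]
  nlinarith [mul_le_mul_of_nonneg_left (Φ.norm_op_le t x) hi.le]

/-- Solving `u - G N u = x - y` and projecting gives core elements `z N` with `z N - G N (u N) = P N
(x - y)`. Dissipativity applied to `x - z N` forces `z N → x`, and then `G N (u N) → y`. -/
theorem HasOrbitDeriv.mem_closure_core {x y : E} (h : Φ.HasOrbitDeriv x y) :
    (x, y) ∈ closure Φ.core := by
  choose u hu using fun N => exists_sub_apply_eq (Φ.norm_le N) (x - y)
  set z : ℕ+ → E := fun N => Φ.P N (u N)
  have hz : ∀ N, z N - Φ.G N (u N) = Φ.P N (x - y) := fun N => by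
    rw [← hu N, map_sub, Φ.P_G]
  have hcore : ∀ N, (z N, Φ.G N (u N)) ∈ Φ.core := fun N => ⟨N, u N, rfl⟩
  have hsub : ∀ N, ‖x - z N‖ ≤ ‖(x - y) - Φ.P N (x - y)‖ := by
    intro N
    have := (h.sub (Φ.hasOrbitDeriv_of_mem_closure_core (subset_closure (hcore N)))).norm_le
    rw [← hz N]
    convert this using 2
    abel
  have hlim := Φ.tendsto_P (x - y)
  have hzx : Tendsto z atTop (𝓝 x) := by
    rw [tendsto_iff_norm_sub_tendsto_zero]
    refine squeeze_zero (fun _ => norm_nonneg _) (fun N => ?_)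
      (g := fun N => ‖(x - y) - Φ.P N (x - y)‖) ?_
    · rw [norm_sub_rev]; exact hsub N
    · simpa using ((tendsto_const_nhds (x := x - y)).sub hlim).norm
  have hGz : Tendsto (fun N => Φ.G N (u N)) atTop (𝓝 y) := by
    have := hzx.sub hlim
    rw [sub_sub_cancel] at this
    refine this.congr fun N => ?_
    rw [← hz N, sub_sub_cancel]
  exact mem_closure_of_tendsto (hzx.prodMk_nhds hGz) (Eventually.of_forall hcore)

theorem mem_closure_core_iff {x y : E} : (x, y) ∈ closure Φ.core ↔ Φ.HasOrbitDeriv x y :=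
  ⟨Φ.hasOrbitDeriv_of_mem_closure_core, HasOrbitDeriv.mem_closure_core⟩

/-- An operator between the core and its closure is closable, and its closure generates the
semigroup. -/
theorem isClosable_and_isGeneratedBy {T : E →ₗ.[ℝ] E} (h1 : Φ.core ⊆ T.graph)
    (h2 : (T.graph : Set (E × E)) ⊆ closure Φ.core) :
    T.IsClosable ∧ Φ.semigroup.IsGeneratedBy T.closure := by
  have hcl : ∀ p, p ∈ T.graph.topologicalClosure ↔ p ∈ closure Φ.core := fun p =>
    ⟨fun hp => closure_minimal h2 isClosed_closure hp, fun hp => closure_mono h1 hp⟩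
  have hT : T.IsClosable := by
    refine ⟨T.graph.topologicalClosure.toLinearPMap, ?_⟩
    rw [Submodule.toLinearPMap_graph_eq]
    -- The closure of the graph is single-valued because the orbit of `0` has derivative `0`.
    rintro ⟨x, y⟩ hp (rfl : x = 0)
    have := mem_closure_core_iff.1 ((hcl _).1 hp)
    refine tendsto_nhds_unique this ?_
    simp
  refine ⟨hT, fun x y => ?_⟩
  rw [← hT.graph_closure_eq_closure_graph, hcl]
  exact mem_closure_core_iff

end FiniteSections

end

/-! ### The weighted space: completeness, unit vectors, positive cone, truncations. -/

noncomputable section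

theorem tendsto_finset_Icc_one_atTop :
    Tendsto (fun N : ℕ+ => Finset.Icc 1 N) atTop atTop :=
  tendsto_atTop_finset_of_monotone (fun _ _ h => Finset.Icc_subset_Icc_right h)
    fun n => ⟨n, Finset.mem_Icc.2 ⟨one_le, le_rfl⟩⟩

theorem HasSum.tendsto_sum_Icc_one {E : Type*} [AddCommMonoid E] [TopologicalSpace E]
    {f : ℕ+ → E} {s : E} (h : HasSum f s) :
    Tendsto (fun N : ℕ+ => ∑ j ∈ Finset.Icc 1 N, f j) atTop (𝓝 s) := by
  rw [HasSum, SummationFilter.unconditional_filter] at h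
  exact h.comp tendsto_finset_Icc_one_atTop

namespace WeightedL1

variable {w : Weight}

theorem ext {f g : WeightedL1 w} (h : ∀ n, f n = g n) : f = g := Subtype.ext (funext h)

/-- The isometric isomorphism of `ℓ¹_w` with the unweighted space `ℓ¹`. -/
def equivLp (w : Weight) : WeightedL1 w ≃ₗᵢ[ℝ] lp (fun _ : ℕ+ => ℝ) 1 where
  toFun f := ⟨fun n => w n * f n, by
    refine memℓp_gen ?_
    refine (summable f).congr fun n => ?_
    simp [abs_of_pos (w.pos n)]⟩
  invFun g := ⟨fun n => (w n)⁻¹ * g n, by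
    have hg : Summable fun n => ‖g n‖ := by simpa using (lp.memℓp g).summable (by simp)
    refine Set.mem_ofPred.2 (hg.congr fun n => ?_)
    rw [abs_mul, abs_of_pos (inv_pos.2 (w.pos n)), mul_inv_cancel_left₀ (w.pos n).ne']
    rfl⟩
  left_inv f := ext fun n => inv_mul_cancel_left₀ (w.pos n).ne' (f n)
  right_inv g := Subtype.ext (funext fun n => mul_inv_cancel_left₀ (w.pos n).ne' (g n))
  map_add' f g := Subtype.ext (funext fun n => by
    change w n * (f + g) n = w n * f n + w n * g n
    simp [mul_add])
  map_smul' c f := Subtype.ext (funext fun n => by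
    change w n * (c • f) n = c * (w n * f n)
    simp [mul_left_comm])
  norm_map' f := by
    rw [lp.norm_eq_tsum_rpow (by simp), norm_def]
    simp only [ENNReal.toReal_one, Real.rpow_one, one_div, inv_one]
    refine tsum_congr fun n => ?_
    change |w n * f n| = w n * |f n|
    rw [abs_mul, abs_of_pos (w.pos n)]

instance : CompleteSpace (WeightedL1 w) :=
  (equivLp w).toIsometryEquiv.completeSpace

theorem hasSum_norm (f : WeightedL1 w) : HasSum (fun n => w n * |f n|) ‖f‖ := (summable f).hasSum

theorem weight_mul_abs_le (f : WeightedL1 w) (n : ℕ+) : w n * |f n| ≤ ‖f‖ :=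
  le_hasSum (hasSum_norm f) n fun m _ => mul_nonneg (w.pos m).le (abs_nonneg _)

/-- The `n`-th coordinate functional. -/
def coord (w : Weight) (n : ℕ+) : WeightedL1 w →L[ℝ] ℝ :=
  LinearMap.mkContinuous ((LinearMap.proj n).comp (toSeq w)) (w n)⁻¹ fun f => by
    rw [← div_eq_inv_mul, le_div_iff₀' (w.pos n)]
    exact weight_mul_abs_le f n

@[simp]
theorem coord_apply (f : WeightedL1 w) (n : ℕ+) : coord w n f = f n := rfl

/-- The `n`-th unit vector. -/
def unit (w : Weight) (n : ℕ+) : WeightedL1 w :=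
  ⟨Pi.single n 1, summable_of_hasFiniteSupport <| (Set.finite_singleton n).subset fun m hm => by
    by_contra h
    exact hm (by simp [Pi.single_eq_of_ne h])⟩

theorem unit_apply (n m : ℕ+) : unit w n m = if m = n then 1 else 0 := by
  change (Pi.single n 1 : ℕ+ → ℝ) m = _
  rw [Pi.single_apply]

theorem norm_unit (n : ℕ+) : ‖unit w n‖ = w n := by
  rw [norm_def, tsum_eq_single n]
  · simp [unit_apply]
  · intro m hm
    simp [unit_apply, hm]

theorem norm_smul_unit (f : WeightedL1 w) (n : ℕ+) : ‖f n • unit w n‖ = w n * |f n| := by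
  rw [norm_smul, norm_unit, Real.norm_eq_abs, mul_comm]

theorem hasSum_smul_unit (f : WeightedL1 w) : HasSum (fun n => f n • unit w n) f := by
  have hs : Summable fun n => f n • unit w n :=
    Summable.of_norm ((summable f).congr fun n => (norm_smul_unit f n).symm)
  have h : ∑' n, f n • unit w n = f := by
    refine ext fun m => ?_
    have h1 := hs.hasSum.mapL (coord w m)
    refine h1.unique ?_
    convert hasSum_ite_eq m (f m) using 2 with n
    by_cases hn : n = m
    · simp [hn, unit_apply]
    · simp [hn, Ne.symm hn, unit_apply]
  have h1 := hs.hasSum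
  rwa [h] at h1

theorem hasSum_smul_apply_unit {F : Type*} [NormedAddCommGroup F] [NormedSpace ℝ F]
    (T : WeightedL1 w →L[ℝ] F) (f : WeightedL1 w) :
    HasSum (fun n => f n • T (unit w n)) (T f) := by
  simpa using (hasSum_smul_unit f).mapL T

/-- On an `ℓ¹` space an operator bound can be checked column by column, since `f = ∑ f n • unit w n`
converges absolutely with norms adding up to `‖f‖`. -/
theorem opNorm_le_of_unit {F : Type*} [NormedAddCommGroup F] [NormedSpace ℝ F]
    (T : WeightedL1 w →L[ℝ] F) {C : ℝ} (hC : 0 ≤ C) (h : ∀ n, ‖T (unit w n)‖ ≤ C * w n) :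
    ‖T‖ ≤ C := by
  refine T.opNorm_le_bound hC fun f => ?_
  refine (hasSum_smul_apply_unit T f).norm_le_of_bounded ((hasSum_norm f).mul_left C) fun n => ?_
  rw [norm_smul, Real.norm_eq_abs]
  calc |f n| * ‖T (unit w n)‖ ≤ |f n| * (C * w n) :=
        mul_le_mul_of_nonneg_left (h n) (abs_nonneg _)
    _ = C * (w n * |f n|) := by ring

variable (w) in
/-- The cone of nonnegative sequences. -/
def nonnegCone : PointedCone ℝ (WeightedL1 w) where
  carrier := {f | ∀ n, 0 ≤ f n}
  zero_mem' := fun n => by simp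
  add_mem' := fun hf hg n => by simpa using add_nonneg (hf n) (hg n)
  smul_mem' := fun c f hf n => mul_nonneg c.2 (hf n)

theorem mem_nonnegCone {f : WeightedL1 w} : f ∈ nonnegCone w ↔ ∀ n, 0 ≤ f n := Iff.rfl

theorem isClosed_nonnegCone : IsClosed (nonnegCone w : Set (WeightedL1 w)) := by
  have : (nonnegCone w : Set (WeightedL1 w)) = ⋂ n, {f | 0 ≤ coord w n f} := by
    ext f
    rw [Set.mem_iInter]
    exact mem_nonnegCone
  rw [this]
  exact isClosed_iInter fun n => isClosed_le continuous_const (coord w n).continuous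

theorem unit_mem_nonnegCone (n : ℕ+) : unit w n ∈ nonnegCone w := fun m => by
  rw [unit_apply]
  split_ifs <;> norm_num

theorem apply_mem_nonnegCone {T : WeightedL1 w →L[ℝ] WeightedL1 w}
    (h : ∀ n, T (unit w n) ∈ nonnegCone w) {f : WeightedL1 w} (hf : f ∈ nonnegCone w) :
    T f ∈ nonnegCone w :=
  isClosed_nonnegCone.mem_of_tendsto (hasSum_smul_apply_unit T f) <|
    Eventually.of_forall fun _ => Submodule.sum_mem _ fun n _ =>
      (nonnegCone w).smul_mem (hf n) (h n)

theorem hasSum_weight_mul_of_nonneg {f : WeightedL1 w} (hf : ∀ n, 0 ≤ f n) :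
    HasSum (fun n => w n * f n) ‖f‖ := by
  convert hasSum_norm f using 3 with n
  rw [abs_of_nonneg (hf n)]

theorem summable_weight_mul (f : WeightedL1 w) : Summable fun n => w n * f n := by
  refine Summable.of_norm ((summable f).congr fun n => ?_)
  rw [norm_mul, Real.norm_eq_abs, abs_of_pos (w.pos n), Real.norm_eq_abs]

variable (w) in
/-- The functional `f ↦ ∑ w_n f_n`, which agrees with the norm on the positive cone. -/
def mass : WeightedL1 w →L[ℝ] ℝ :=
  LinearMap.mkContinuous
    { toFun := fun f => ∑' n, w n * f n
      map_add' := fun f g => by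
        rw [← (summable_weight_mul f).tsum_add (summable_weight_mul g)]
        simp [mul_add]
      map_smul' := fun c f => by
        rw [RingHom.id_apply, smul_eq_mul, ← tsum_mul_left]
        simp [mul_left_comm] }
    1 fun f => by
      rw [one_mul]
      refine (summable_weight_mul f).hasSum.norm_le_of_bounded (hasSum_norm f) fun n => ?_
      rw [norm_mul, Real.norm_eq_abs, abs_of_pos (w.pos n), Real.norm_eq_abs]

theorem mass_of_nonneg {f : WeightedL1 w} (hf : ∀ n, 0 ≤ f n) : mass w f = ‖f‖ :=
  (hasSum_weight_mul_of_nonneg hf).tsum_eq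

theorem mass_unit (n : ℕ+) : mass w (unit w n) = w n := by
  rw [mass_of_nonneg (unit_mem_nonnegCone n), norm_unit]

/-- The inclusion of weighted spaces for `w ≤ v`. -/
def incl {v w : Weight} (h : ∀ n, w n ≤ v n) : WeightedL1 v →L[ℝ] WeightedL1 w :=
  have hle (f : WeightedL1 v) (n : ℕ+) : w n * |f n| ≤ v n * |f n| :=
    mul_le_mul_of_nonneg_right (h n) (abs_nonneg _)
  have hs (f : WeightedL1 v) : Summable fun n => w n * |f n| :=
    (summable f).of_nonneg_of_le (fun n => mul_nonneg (w.pos n).le (abs_nonneg _)) (hle f)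
  LinearMap.mkContinuous
    { toFun := fun f => (⟨toSeq v f, hs f⟩ : WeightedL1 w)
      map_add' := fun f g => ext fun n => by
        change toSeq v (f + g) n = toSeq v f n + toSeq v g n
        simp
      map_smul' := fun c f => ext fun n => by
        change toSeq v (c • f) n = c * toSeq v f n
        simp }
    1 fun f => by
      rw [one_mul]
      exact (hs f).tsum_le_tsum (hle f) (summable f)

@[simp]
theorem incl_apply {v w : Weight} (h : ∀ n, w n ≤ v n) (f : WeightedL1 v) (n : ℕ+) :
    incl h f n = f n := rfl

theorem incl_unit {v w : Weight} (h : ∀ n, w n ≤ v n) (n : ℕ+) :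
    incl h (unit v n) = unit w n := rfl

variable (w) in
/-- The projection on the first `N` coordinates. -/
def truncate (N : ℕ+) : WeightedL1 w →L[ℝ] WeightedL1 w :=
  ∑ j ∈ Finset.Icc 1 N, (coord w j).smulRight (unit w j)

theorem truncate_apply (N : ℕ+) (f : WeightedL1 w) :
    truncate w N f = ∑ j ∈ Finset.Icc 1 N, f j • unit w j := by
  simp [truncate]

theorem tendsto_truncate (f : WeightedL1 w) :
    Tendsto (fun N => truncate w N f) atTop (𝓝 f) := by
  simp only [truncate_apply]
  exact (hasSum_smul_unit f).tendsto_sum_Icc_one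

theorem truncate_apply_apply (N n : ℕ+) (f : WeightedL1 w) :
    truncate w N f n = if n ≤ N then f n else 0 := by
  rw [truncate_apply, ← coord_apply, map_sum]
  simp [unit_apply]

theorem truncate_unit_of_le {N n : ℕ+} (h : n ≤ N) : truncate w N (unit w n) = unit w n :=
  ext fun m => by
    rw [truncate_apply_apply, unit_apply]
    by_cases hm : m = n
    · simp [hm, h]
    · simp [hm]

end WeightedL1

end

/-! ### Finite sections of the fragmentation operator. -/

noncomputable section

open WeightedL1

section Fragmentation

variable (w : Weight) (a : ℕ+ → ℝ) (b : ℕ+ → ℕ+ → ℝ)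

/-- The vector `(b_{n,j})_{n < j}`. -/
def fragments (j : ℕ+) : WeightedL1 w := ∑ n ∈ Finset.Iio j, b n j • unit w n

/-- The image of the `j`-th unit vector under `A + B`. -/
def column (j : ℕ+) : WeightedL1 w := a j • (fragments w b j - unit w j)

/-- The operator `A + B` composed with the projection on the first `N` coordinates. -/
def fragSection (N : ℕ+) : WeightedL1 w →L[ℝ] WeightedL1 w :=
  ∑ j ∈ Finset.Icc 1 N, (coord w j).smulRight (column w a b j)

variable {w a b}

theorem fragments_apply (j n : ℕ+) : fragments w b j n = if n < j then b n j else 0 := by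
  rw [fragments, ← coord_apply, map_sum]
  simp [unit_apply]

theorem fragSection_apply (N : ℕ+) (f : WeightedL1 w) :
    fragSection w a b N f = ∑ j ∈ Finset.Icc 1 N, f j • column w a b j := by
  simp [fragSection]

theorem fragSection_unit (N j : ℕ+) :
    fragSection w a b N (unit w j) = if j ≤ N then column w a b j else 0 := by
  rw [fragSection_apply]
  simp [unit_apply]

/-- Triangularity: fragments of `j` have index below `j`, so the span of the first `N` unit vectors
is invariant. -/
theorem truncate_column {N j : ℕ+} (h : j ≤ N) :
    truncate w N (column w a b j) = column w a b j := by
  rw [column, fragments, map_smul, map_sub, map_sum, truncate_unit_of_le h]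
  congr 2
  refine Finset.sum_congr rfl fun n hn => ?_
  rw [map_smul, truncate_unit_of_le ((Finset.mem_Iio.1 hn).le.trans h)]

theorem truncate_fragSection (N : ℕ+) (f : WeightedL1 w) :
    truncate w N (fragSection w a b N f) = fragSection w a b N f := by
  rw [fragSection_apply, map_sum]
  refine Finset.sum_congr rfl fun j hj => ?_
  rw [map_smul, truncate_column (Finset.mem_Icc.1 hj).2]

theorem fragSection_truncate {M N : ℕ+} (h : N ≤ M) (f : WeightedL1 w) :
    fragSection w a b M (truncate w N f) = fragSection w a b N f := by
  rw [truncate_apply, map_sum, fragSection_apply]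
  refine Finset.sum_congr rfl fun j hj => ?_
  rw [map_smul, fragSection_unit, if_pos ((Finset.mem_Icc.1 hj).2.trans h)]

theorem norm_fragments_le (hb : ∀ n j, 0 ≤ b n j)
    (hwb : ∀ j, ∑ n ∈ Finset.Iio j, w n * b n j ≤ w j) (j : ℕ+) : ‖fragments w b j‖ ≤ w j := by
  refine (norm_sum_le _ _).trans (le_trans (le_of_eq ?_) (hwb j))
  refine Finset.sum_congr rfl fun n _ => ?_
  rw [norm_smul, norm_unit, Real.norm_eq_abs, abs_of_nonneg (hb n j), mul_comm]

theorem fragments_mem_nonnegCone (hb : ∀ n j, 0 ≤ b n j) (j : ℕ+) :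
    fragments w b j ∈ nonnegCone w := fun n => by
  rw [fragments_apply]
  split_ifs
  exacts [hb n j, le_rfl]

/-- The partial sums of the rates `a_j`, which bound the first `N` of them. -/
def rateBound (a : ℕ+ → ℝ) (N : ℕ+) : ℝ := ∑ j ∈ Finset.Icc 1 N, a j

theorem rateBound_nonneg (ha : ∀ n, 0 ≤ a n) (N : ℕ+) : 0 ≤ rateBound a N :=
  Finset.sum_nonneg fun j _ => ha j

theorem le_rateBound (ha : ∀ n, 0 ≤ a n) {N j : ℕ+} (h : j ≤ N) : a j ≤ rateBound a N :=
  Finset.single_le_sum (f := a) (fun i _ => ha i) (Finset.mem_Icc.2 ⟨one_le, h⟩)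

theorem column_add_smul (j : ℕ+) (r : ℝ) :
    column w a b j + r • unit w j = (r - a j) • unit w j + a j • fragments w b j := by
  rw [column, smul_sub, sub_smul]
  abel

/-- With `α = rateBound a N`, a column `j ≤ N` has norm at most `(α - a j) w j + a j w j = α w j`;
the first coefficient is nonnegative because `a j ≤ α`. A column `j > N` is just `α • unit w j`. -/
theorem norm_fragSection_add_le (ha : ∀ n, 0 ≤ a n) (hb : ∀ n j, 0 ≤ b n j)
    (hwb : ∀ j, ∑ n ∈ Finset.Iio j, w n * b n j ≤ w j) (N : ℕ+) :
    ‖fragSection w a b N + rateBound a N • (1 : WeightedL1 w →L[ℝ] WeightedL1 w)‖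
      ≤ rateBound a N := by
  have h0 := rateBound_nonneg ha N
  refine opNorm_le_of_unit _ h0 fun j => ?_
  rw [add_apply, smul_apply, one_apply_eq_self, fragSection_unit]
  split_ifs with hj
  · have h1 := le_rateBound ha hj
    rw [column_add_smul]
    refine (norm_add_le _ _).trans ?_
    rw [norm_smul, norm_smul, norm_unit, Real.norm_eq_abs, Real.norm_eq_abs,
      abs_of_nonneg (ha j), abs_of_nonneg (sub_nonneg.2 h1)]
    nlinarith [mul_le_mul_of_nonneg_left (norm_fragments_le hb hwb j) (ha j)]
  · rw [zero_add, norm_smul, norm_unit, Real.norm_eq_abs, abs_of_nonneg h0]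

/-- The finite sections of the fragmentation operator `A + B`. -/
def fragSections (w : Weight) {a : ℕ+ → ℝ} {b : ℕ+ → ℕ+ → ℝ} (ha : ∀ n, 0 ≤ a n)
    (hb : ∀ n j, 0 ≤ b n j) (hwb : ∀ j, ∑ n ∈ Finset.Iio j, w n * b n j ≤ w j) :
    FiniteSections (WeightedL1 w) where
  P := truncate w
  G := fragSection w a b
  α := rateBound a
  tendsto_P := tendsto_truncate
  P_G := truncate_fragSection
  G_P _ _ f h := fragSection_truncate h f
  norm_le := norm_fragSection_add_le ha hb hwb

/-! ### Positivity, conservation of mass and change of weight. -/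

section Semigroup

variable (ha : ∀ n, 0 ≤ a n) (hb : ∀ n j, 0 ≤ b n j)
  (hwb : ∀ j, ∑ n ∈ Finset.Iio j, w n * b n j ≤ w j)

theorem fragSections_op_nonneg (t : ℝ≥0) {f : WeightedL1 w} (hf : 0 ≤ f) :
    0 ≤ (fragSections w ha hb hwb).semigroup.op t f := by
  refine (fragSections w ha hb hwb).op_mem_cone isClosed_nonnegCone (fun N g hg => ?_) t hf
  refine apply_mem_nonnegCone (T := fragSection w a b N + rateBound a N • 1) (fun j => ?_) hg
  rw [add_apply, smul_apply, one_apply_eq_self, fragSection_unit]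
  split_ifs with hj
  · rw [column_add_smul]
    exact Submodule.add_mem _
      ((nonnegCone w).smul_mem (sub_nonneg.2 (le_rateBound ha hj)) (unit_mem_nonnegCone j))
      ((nonnegCone w).smul_mem (ha j) (fragments_mem_nonnegCone hb j))
  · rw [zero_add]
    exact (nonnegCone w).smul_mem (rateBound_nonneg ha N) (unit_mem_nonnegCone j)

theorem fragSections_isSubstochastic : (fragSections w ha hb hwb).semigroup.IsSubstochastic :=
  fun t f hf => ⟨fragSections_op_nonneg ha hb hwb t hf, FiniteSections.norm_op_le _ t f⟩

/-- The mass functional kills every column and equals the norm on the cone. The factor `a j` on both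
sides of the hypothesis admits `j = 1`, where the sum is empty and `a 1 = 0` is needed. -/
theorem fragSections_isStochastic (h : ∀ j, a j * ∑ n ∈ Finset.Iio j, w n * b n j = a j * w j) :
    (fragSections w ha hb hwb).semigroup.IsStochastic := by
  intro t f hf
  have h0 := fragSections_op_nonneg ha hb hwb t hf
  refine ⟨h0, ?_⟩
  rw [← mass_of_nonneg h0, ← mass_of_nonneg hf]
  refine FiniteSections.functional_op_eq _ (mass w) (fun N g => ?_) t f
  change mass w (fragSection w a b N g) = 0
  rw [fragSection_apply, map_sum]
  refine Finset.sum_eq_zero fun j _ => ?_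
  have hj : mass w (fragments w b j) = ∑ n ∈ Finset.Iio j, w n * b n j := by
    rw [fragments, map_sum]
    refine Finset.sum_congr rfl fun n _ => ?_
    rw [map_smul, mass_unit, smul_eq_mul, mul_comm]
  rw [map_smul, column, map_smul, map_sub, mass_unit, hj, smul_eq_mul (a j), mul_sub, h,
    sub_self, smul_zero]

/-- Both semigroups are limits of exponentials of the same matrices, which the inclusion
intertwines. -/
theorem incl_fragSections_op {v : Weight} (hv : ∀ n, w n ≤ v n)
    (hvb : ∀ j, ∑ n ∈ Finset.Iio j, v n * b n j ≤ v j) (t : ℝ≥0) (f : WeightedL1 v) :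
    incl hv ((fragSections v ha hb hvb).semigroup.op t f)
      = (fragSections w ha hb hwb).semigroup.op t (incl hv f) := by
  refine FiniteSections.map_op_eq _ _ _ (fun N g => ?_) t f
  change incl hv (fragSection v a b N g) = fragSection w a b N (incl hv g)
  simp only [fragSection_apply, map_sum, map_smul, incl_apply, column, fragments, map_sub,
    incl_unit]

end Semigroup

/-! ### The maximal sum `A + B` lies between the core and its closure. -/

section Graph

theorem unit_mem_opA_domain (j : ℕ+) : unit w j ∈ (opA w a).domain := by
  have h : (fun n => -a n * unit w j n) = fun n => (-a j • unit w j) n := by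
    funext n
    by_cases hn : n = j
    · simp [unit_apply, hn]
    · simp [unit_apply, hn]
  change (fun n => -a n * unit w j n) ∈ weightedSeq w
  rw [h]
  exact (-a j • unit w j).2

theorem hasGain_unit (j n : ℕ+) : HasGain a b (unit w j) n ((a j • fragments w b j) n) := by
  refine tendsto_const_nhds.congr' ?_
  filter_upwards [eventually_ge_atTop j] with N hN
  rw [Finset.sum_eq_single_of_mem j (Finset.mem_Icc.2 ⟨one_le, hN⟩)]
  · simp [gainTerm, unit_apply, fragments_apply]
  · intro i _ hi
    simp [gainTerm, unit_apply, hi]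

theorem unit_column_mem_graph (j : ℕ+) :
    (unit w j, column w a b j) ∈ (opA w a + opB w a b).graph := by
  have hB : unit w j ∈ (opB w a b).domain := ⟨_, hasGain_unit j⟩
  refine (LinearPMap.mem_graph_iff _).2 ⟨⟨unit w j, unit_mem_opA_domain j, hB⟩, rfl, ?_⟩
  rw [LinearPMap.add_apply]
  refine ext fun n => ?_
  have h1 := tendsto_nhds_unique (opB_apply w a b ⟨unit w j, hB⟩ n) (hasGain_unit j n)
  rw [map_add, Pi.add_apply, h1]
  change -a n * unit w j n + _ = _
  by_cases hn : n = j
  · simp [column, unit_apply, hn, add_comm, sub_eq_add_neg]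
  · simp [column, unit_apply, hn]

variable (ha : ∀ n, 0 ≤ a n) (hb : ∀ n j, 0 ≤ b n j)
  (hwb : ∀ j, ∑ n ∈ Finset.Iio j, w n * b n j ≤ w j)

theorem core_subset_graph :
    (fragSections w ha hb hwb).core ⊆ (opA w a + opB w a b).graph := by
  rintro _ ⟨N, f, rfl⟩
  have h : ((fragSections w ha hb hwb).P N f, (fragSections w ha hb hwb).G N f)
      = ∑ j ∈ Finset.Icc 1 N, f j • (unit w j, column w a b j) := by
    change (truncate w N f, fragSection w a b N f) = _
    rw [truncate_apply, fragSection_apply]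
    refine Prod.ext ?_ ?_
    · simp [Prod.fst_sum]
    · simp [Prod.snd_sum]
  rw [h]
  exact Submodule.sum_mem _ fun j _ => Submodule.smul_mem _ _ (unit_column_mem_graph j)

/-- Membership in the domain of `A` makes `∑ f_j • column j` absolutely convergent, because a column
has norm at most `2 a_j w_j`. Its sum is identified with `(A + B) f` coordinatewise, where the
partial sums are those defining `B` plus the diagonal term. -/
theorem tendsto_fragSection (hb : ∀ n j, 0 ≤ b n j)
    (hwb : ∀ j, ∑ n ∈ Finset.Iio j, w n * b n j ≤ w j) (f : (opA w a + opB w a b).domain) :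
    Tendsto (fun N => fragSection w a b N f.1) atTop (𝓝 ((opA w a + opB w a b) f)) := by
  have hA : Summable fun n => w n * |-a n * f.1 n| := f.2.1
  have hs : Summable fun j => f.1 j • column w a b j := by
    refine Summable.of_norm_bounded (hA.mul_left 2) fun j => ?_
    rw [column, norm_smul, norm_smul, Real.norm_eq_abs, Real.norm_eq_abs, abs_mul, abs_neg]
    have h1 : ‖fragments w b j - unit w j‖ ≤ 2 * w j := by
      refine (norm_sub_le _ _).trans ?_
      rw [norm_unit]
      linarith [norm_fragments_le hb hwb j]
    calc |f.1 j| * (|a j| * ‖fragments w b j - unit w j‖)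
        ≤ |f.1 j| * (|a j| * (2 * w j)) := by gcongr
      _ = 2 * (w j * (|a j| * |f.1 j|)) := by ring
  have hlim := hs.hasSum.tendsto_sum_Icc_one
  simp only [fragSection_apply]
  convert hlim
  refine ext fun n => ?_
  refine tendsto_nhds_unique (f := fun N : ℕ+ => ∑ j ∈ Finset.Icc 1 N, f.1 j * column w a b j n)
    (l := atTop) ?_ ?_
  · have hB := opB_apply w a b ⟨f.1, f.2.2⟩ n
    have h1 := hB.const_add (-a n * f.1 n)
    refine h1.congr' ?_
    filter_upwards [eventually_ge_atTop n] with N hN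
    -- The diagonal term enters the sum only once `N ≥ n`, so the partial sums agree eventually.
    have h2 : -a n * f.1 n = ∑ j ∈ Finset.Icc 1 N, if n = j then -a n * f.1 n else 0 := by
      rw [Finset.sum_ite_eq, if_pos (Finset.mem_Icc.2 ⟨one_le, hN⟩)]
    rw [h2, ← Finset.sum_add_distrib]
    refine Finset.sum_congr rfl fun j _ => ?_
    have h3 : column w a b j n = a j * (fragments w b j n - unit w j n) := by simp [column]
    rw [h3, fragments_apply, unit_apply, gainTerm]
    by_cases hn : n = j
    · subst hn
      simp
      ring
    · simp only [hn, if_false]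
      split_ifs <;> ring
  · have h1 := ((coord w n).continuous.tendsto _).comp hlim
    refine h1.congr fun N => ?_
    simp [map_sum]

theorem graph_subset_closure_core :
    ((opA w a + opB w a b).graph : Set _) ⊆ closure (fragSections w ha hb hwb).core := by
  rintro ⟨x, y⟩ hxy
  obtain ⟨f, rfl, rfl⟩ := (LinearPMap.mem_graph_iff _).1 hxy
  exact mem_closure_of_tendsto
    ((tendsto_truncate f.1).prodMk_nhds (tendsto_fragSection hb hwb f))
    (Eventually.of_forall fun N => ⟨N, f.1, rfl⟩)

end Graph

/-! ### The domain of `C` as a weighted space, and its invariance. -/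

section DiagonalDomain

variable {c : ℕ+ → ℝ}

theorem mem_opC_domain_iff (hc : ∀ n, 0 ≤ c n) (f : WeightedL1 w) :
    f ∈ (opC w c).domain ↔ Summable fun n => (w n + w n * c n) * |f n| := by
  have h : f ∈ (opC w c).domain ↔ Summable fun n => w n * |-c n * f n| := Iff.rfl
  rw [h]
  have h1 : ∀ n, w n * |-c n * f n| = (w n + w n * c n) * |f n| - w n * |f n| := fun n => by
    rw [abs_mul, abs_neg, abs_of_nonneg (hc n)]
    ring
  simp only [h1]
  refine ⟨fun hs => (hs.add (summable f)).congr fun n => by ring, fun hs => hs.sub (summable f)⟩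

theorem opC_domain_map (hc : ∀ n, 0 ≤ c n) :
    (opC w c).domain.map (toSeq w) = weightedSeq fun n => w n + w n * c n := by
  ext f
  rw [Submodule.mem_map]
  constructor
  · rintro ⟨g, hg, rfl⟩
    exact (mem_opC_domain_iff hc g).1 hg
  · intro hf
    have hf' : Summable fun n => (w n + w n * c n) * |f n| := hf
    have hw : Summable fun n => w n * |f n| :=
      hf'.of_nonneg_of_le (fun n => mul_nonneg (w.pos n).le (abs_nonneg _)) fun n =>
        mul_le_mul_of_nonneg_right (le_add_of_nonneg_right (mul_nonneg (w.pos n).le (hc n)))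
          (abs_nonneg _)
    exact ⟨(⟨f, hw⟩ : WeightedL1 w), (mem_opC_domain_iff hc _).2 hf', rfl⟩

/-- The domain of `C` is the weighted space of the weight `w_n + w_n c_n`, on which the same
construction gives a semigroup. -/
theorem fragSections_leavesInvariant (ha : ∀ n, 0 ≤ a n) (hb : ∀ n j, 0 ≤ b n j)
    (hwb : ∀ j, ∑ n ∈ Finset.Iio j, w n * b n j ≤ w j) (hc : ∀ n, 0 ≤ c n) (hmono : Monotone c) :
    (fragSections w ha hb hwb).semigroup.LeavesInvariant (opC w c).domain := by
  intro t f hf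
  rw [mem_opC_domain_iff hc] at hf ⊢
  let v : Weight := ⟨fun n => w n + w n * c n, fun n =>
    add_pos_of_pos_of_nonneg (w.pos n) (mul_nonneg (w.pos n).le (hc n))⟩
  have hv : ∀ n, w n ≤ v n := fun n =>
    le_add_of_nonneg_right (mul_nonneg (w.pos n).le (hc n))
  -- As `c n ≤ c j` for `n < j`, the factor `1 + c n` can be bounded by `1 + c j` and taken out of
  -- the sum.
  have hvb : ∀ j, ∑ n ∈ Finset.Iio j, v n * b n j ≤ v j := fun j => by
    calc ∑ n ∈ Finset.Iio j, v n * b n j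
        ≤ ∑ n ∈ Finset.Iio j, (1 + c j) * (w n * b n j) := by
          refine Finset.sum_le_sum fun n hn => ?_
          have h1 : c n ≤ c j := hmono (Finset.mem_Iio.1 hn).le
          have h2 : 0 ≤ w n * b n j := mul_nonneg (w.pos n).le (hb n j)
          calc v n * b n j = (1 + c n) * (w n * b n j) := by
                change (w n + w n * c n) * b n j = _
                ring
            _ ≤ _ := by gcongr
      _ ≤ (1 + c j) * w j := by
          rw [← Finset.mul_sum]
          exact mul_le_mul_of_nonneg_left (hwb j) (by linarith [hc j])
      _ = v j := by
          change _ = w j + w j * c j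
          ring
  let g : WeightedL1 v := ⟨toSeq w f, hf⟩
  have hg : incl hv g = f := rfl
  rw [← hg, ← incl_fragSections_op ha hb hwb hv hvb]
  exact summable ((fragSections v ha hb hvb).semigroup.op t g)

end DiagonalDomain

end Fragmentation

end

/-! ### The theorem on the fragmentation semigroup. -/

theorem mainTheorem1 (a : ℕ+ → ℝ) (b : ℕ+ → ℕ+ → ℝ) (w : Weight) (κ : ℝ)
    (ha : ∀ n, 0 ≤ a n)
    (hb : ∀ n j, 0 ≤ b n j)
    (hb_zero : ∀ n j, j ≤ n → b n j = 0)
    (hw : ∀ n : ℕ+, (n : ℝ) ≤ w n)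
    (hκ_pos : 0 < κ) (hκ_le : κ ≤ 1)
    (hwb : ∀ j : ℕ+, 2 ≤ j → ∑ n ∈ Finset.Iio j, w n * b n j ≤ κ * w j) :
    (opA w a + opB w a b).IsClosable ∧
    ∃ S : C0Semigroup (WeightedL1 w),
      S.IsGeneratedBy (opA w a + opB w a b).closure ∧
      S.IsSubstochastic ∧
      (∀ c : ℕ+ → ℝ, (∀ n, c n ≤ c (n + 1)) → (∀ n, a n ≤ c n) →
        (opC w c).domain.map (WeightedL1.toSeq w) = weightedSeq (fun n => w n + w n * c n) ∧
        S.LeavesInvariant (opC w c).domain) ∧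
      (a 1 = 0 → (∀ j : ℕ+, 2 ≤ j → ∑ n ∈ Finset.Iio j, (n : ℝ) * b n j = (j : ℝ)) →
        (∀ n : ℕ+, w n = (n : ℝ)) → S.IsStochastic) := by
  -- Only the bound with constant `1` is needed; it extends to `j = 1`, where the sum is empty.
  have hwb' : ∀ j, ∑ n ∈ Finset.Iio j, w n * b n j ≤ w j := by
    intro j
    rcases eq_or_ne j 1 with rfl | hj
    · have h1 : Finset.Iio (1 : ℕ+) = ∅ := by
        ext n
        simp
      rw [h1, Finset.sum_empty]
      exact (w.pos 1).le
    · have h2 : 2 ≤ j := PNat.add_one_le_iff.2 (lt_of_le_of_ne one_le hj.symm)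
      refine (hwb j h2).trans ?_
      exact mul_le_of_le_one_left (w.pos j).le hκ_le
  obtain ⟨hclosable, hgen⟩ := FiniteSections.isClosable_and_isGeneratedBy
    (core_subset_graph ha hb hwb') (graph_subset_closure_core ha hb hwb')
  refine ⟨hclosable, (fragSections w ha hb hwb').semigroup, hgen,
    fragSections_isSubstochastic ha hb hwb', fun c hc hac => ?_, fun ha1 hmass hwn => ?_⟩
  · have hc0 : ∀ n, 0 ≤ c n := fun n => (ha n).trans (hac n)
    have hmono : Monotone c := by
      intro m n hmn
      induction n using PNat.recOn with
      | one => rw [le_antisymm hmn one_le]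
      | succ n ih =>
        rcases hmn.lt_or_eq with h | rfl
        · exact (ih (PNat.lt_add_one_iff.1 h)).trans (hc n)
        · exact le_rfl
    exact ⟨opC_domain_map hc0, fragSections_leavesInvariant ha hb hwb' hc0 hmono⟩
  · refine fragSections_isStochastic ha hb hwb' fun j => ?_
    rcases eq_or_ne j 1 with rfl | hj
    · rw [ha1, zero_mul, zero_mul]
    · have h2 : 2 ≤ j := PNat.add_one_le_iff.2 (lt_of_le_of_ne one_le hj.symm)
      simp only [hwn, hmass j h2]
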